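/- A **nonlocal game** $\mathfrak G$ with $n$ questions and $m$ answers consists of a probability distribution $\mu$ on $[n]\times[n]$ and a decision function $D:[n]\times[n]\times[m]\times[m]\to\{0,1\}$. A **PVM** on a Hilbert space is a finite sequence of (orthogonal) projections $(C_a)_{a\in[m]}$ with $\sum_a C_a=1$. Let $C_{qc}(n,m)$ be the set of correlations of the form $p(a,b|x,y)=\langle A^x_aB^y_b\xi,\xi\rangle$, where $\xi$ is a unit vector in a separable complex Hilbert space $H$ and, for all $x,y\in[n]$, $(A^x_a)_{a\in[m]}$ and $(B^y_b)_{b\in[m]}$ are PVMs on $H$ with $A^x_aB^y_b=B^y_bA^x_a$ for all $a,b$. Let $C^s_{qc}(n,m)$ be the set of those $p\in C_{qc}(n,m)$ that are synchronous, i.e. $p(a,b|x,x)=0$ whenever $a\neq b$. The **synchronous quantum-commuting value** of $\mathfrak G$ is $$\operatorname{s-val}^{co}(\mathfrak G)=\sup_{p\in C^s_{qc}(n,m)}\ \sum_{v,w}\mu(v,w)\sum_{i,j}D(v,w,i,j)\,p(i,j|v,w)$$ (with the convention $\sup\emptyset=0$, which matters only for $m=0$). A mapping $z\mapsto\mathfrak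 G_z$ from strings $z\in\{0,1\}^*$ to nonlocal games is called **effective** if the numbers $n_z,m_z$ of questions and answers are computable from $z$, the value $D_z(v,w,i,j)$ is computable from $(z,v,w,i,j)$, and the probabilities $\mu_z(v,w)$ are computable reals uniformly in $z$, that is, from $(z,v,w,k)$ one can compute a dyadic rational within $2^{-k}$ of $\mu_z(v,w)$. No bound on the running time is imposed; in particular mappings given by polynomial-time verifiers are effective. For real $0<r\le 1$ let $\operatorname{MIP}^{co,s}_{0,r}$ be the class of languages $L\subseteq\{0,1\}^*$ for which there is an effective mapping $z\mapsto\mathfrak G_z$ such that, for all strings $z$, $z\in L$ if and only if $\operatorname{s-val}^{co}(\mathfrak G_z)\ge r$. **Theorem.** Let $0<r\le 1$ be a real number such that the set of nonnegative rationals smaller than $r$ is recursively enumerable (for example, any computable real, such as $r=1$ or any rational $r$). Then every language $L$ in $\operatorname{MIP}^{co,s}_{0,r}$ belongs to coRE, that is, the complement $\{0,1\}^*\setminus L$ is recursively enumerable. -/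

import Mathlib

/-- A projection valued measure on `H` with `m` outcomes: orthogonal projections summing to `1`. -/
def IsPVM {H : Type} [NormedAddCommGroup H] [InnerProductSpace ℂ H] [CompleteSpace H] {m : ℕ}
    (C : Fin m → (H →L[ℂ] H)) : Prop :=
  (∀ a, IsStarProjection (C a)) ∧ ∑ a, C a = 1

/-- A candidate correlation: `p a b x y` stands for `p(a, b | x, y)`. -/
abbrev Correlation (n m : ℕ) : Type := Fin m → Fin m → Fin n → Fin n → ℝ

/-- The set `C_qc(n, m)` of quantum commuting correlations: `p(a,b|x,y) = ⟨A^x_a B^y_b ξ, ξ⟩` for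
commuting families of PVMs on a separable complex Hilbert space and a unit vector `ξ`. (Mathlib's
inner product is linear in its second argument. Every separable Hilbert space is isometrically
isomorphic to one whose underlying type lies in `Type`.) -/
def Cqc (n m : ℕ) : Set (Correlation n m) :=
  {p | ∃ (H : Type) (_ : NormedAddCommGroup H) (_ : InnerProductSpace ℂ H) (_ : CompleteSpace H)
      (_ : TopologicalSpace.SeparableSpace H) (A B : Fin n → Fin m → (H →L[ℂ] H)) (ξ : H),
      ‖ξ‖ = 1 ∧ (∀ x, IsPVM (A x)) ∧ (∀ y, IsPVM (B y)) ∧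
      (∀ x y a b, A x a * B y b = B y b * A x a) ∧
      ∀ a b x y, (p a b x y : ℂ) = inner ℂ ξ ((A x a) ((B y b) ξ))}

/-- The set `C_qc^s(n, m)` of synchronous quantum commuting correlations. -/
def CqcSync (n m : ℕ) : Set (Correlation n m) :=
  {p | p ∈ Cqc n m ∧ ∀ a b x, a ≠ b → p a b x x = 0}

/-- A nonlocal game with `n` questions and `m` answers: a probability distribution `μ` on pairs of
questions together with a decision function `D` (`true` meaning `1`, `false` meaning `0`). -/
structure NonlocalGame where
  n : ℕ
  m : ℕ
  μ : Fin n → Fin n → ℝ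
  μ_nonneg : ∀ v w, 0 ≤ μ v w
  μ_sum : ∑ v, ∑ w, μ v w = 1
  D : Fin n → Fin n → Fin m → Fin m → Bool

/-- The winning probability of the correlation `p` in the game `G`. -/
def NonlocalGame.winProb (G : NonlocalGame) (p : Correlation G.n G.m) : ℝ :=
  ∑ v, ∑ w, G.μ v w * ∑ i, ∑ j, (if G.D v w i j then (1 : ℝ) else 0) * p i j v w

/-- The synchronous quantum commuting value `s-val^co(G)`. All winning probabilities lie in
`[0, 1]`; for `m = 0` there are no correlations and the supremum is `0` by convention. -/
noncomputable def NonlocalGame.sValCo (G : NonlocalGame) : ℝ :=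
  sSup (G.winProb '' CqcSync G.n G.m)

/-- An effective mapping `z ↦ G z` from strings to nonlocal games: the numbers of questions and
answers and the decision function are computable from `z`, and the question probabilities are
computable reals, uniformly in `z` (a dyadic approximation to within `2 ^ (-k)` is computable from
`z`, the pair of questions and `k`). No bound on the running time is imposed, so that every
efficient mapping is effective. -/
structure IsEffectiveGameMap (G : List Bool → NonlocalGame) : Prop where
  n_computable : Computable fun z => (G z).n
  m_computable : Computable fun z => (G z).m
  D_computable : ∃ d : List Bool × ℕ × ℕ × ℕ × ℕ → Bool, Computable d ∧
    ∀ z (v w : Fin (G z).n) (i j : Fin (G z).m), d (z, v, w, i, j) = (G z).D v w i j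
  μ_computable : ∃ q : List Bool × ℕ × ℕ × ℕ → ℕ, Computable q ∧
    ∀ z (v w : Fin (G z).n) (k : ℕ),
      |(G z).μ v w - (q (z, v, w, k) : ℝ) / 2 ^ k| ≤ 1 / 2 ^ k

/-- The class `MIP^{co,s}_{0,r}`: languages `L` for which there is an effective mapping `z ↦ G z`
from strings to nonlocal games with `z ∈ L` if and only if `s-val^co(G z) ≥ r`. -/
def MIPcoSync (r : ℝ) : Set (Language Bool) :=
  {L | ∃ G : List Bool → NonlocalGame, IsEffectiveGameMap G ∧ ∀ z, z ∈ L ↔ r ≤ (G z).sValCo}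

/-- The class coRE: languages whose complement is recursively enumerable. -/
def coRE : Set (Language Bool) :=
  {L | REPred fun z : List Bool => z ∉ L}

/-- A positive real `r` is lower semicomputable if the set of nonnegative rationals below it,
written as fractions `a / (b + 1)`, is recursively enumerable. Every computable real is. -/
def LowerSemicomputable (r : ℝ) : Prop :=
  REPred fun q : ℕ × ℕ => (q.1 : ℝ) / ((q.2 : ℝ) + 1) < r

/-! Synchronous quantum commuting correlations are exactly those read off from moment functions `φ`
on words in the letters `A^x_a`, `B^y_b`: normalised, bounded by 1, positive semidefinite, and
compatible with the projection, commutation, PVM and synchronicity relations. A strategy gives such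
a `φ` by the real parts of `⟨ξ, w ξ⟩`, which suffice because the relations have real coefficients
and correlations are real (`isSyncMoment_of_strategy`). Conversely, the GNS construction turns `φ`
into a strategy (`IsSyncMoment.momentCorrelation_mem`).

Positivity need only be required for integer coefficients. With the condition that the winning
probability be at least `a / (b + 1)`, this is a recursively enumerable system of integral linear
inequalities in countably many variables in `[-1, 1]` (`GameData.feasible_iff`,
`winForm_eval_nonneg_iff`). By compactness of the cube, infeasibility shows on a finite grid: for
some mesh every grid point violates an inequality by more than the rounding error, which can be
semi-decided (`LinForm.re_not_feasible`). Finally, the value is below `r` iff the system is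
infeasible for some rational below `r` (`NonlocalGame.sValCo_lt_iff`), and these rationals can be
enumerated. -/

/-! ### Closure properties of recursively enumerable predicates. -/

namespace REPred

variable {α β : Type*} [Primcodable α] [Primcodable β]

theorem comp {p : β → Prop} (hp : REPred p) {f : α → β} (hf : Computable f) :
    REPred fun a => p (f a) :=
  Partrec.comp hp hf

theorem and {p q : α → Prop} (hp : REPred p) (hq : REPred q) : REPred fun a => p a ∧ q a := by
  have h : Partrec fun a => (Part.assert (p a) fun _ => Part.some ()).bind fun _ =>
      Part.assert (q a) fun _ => Part.some () :=
    Partrec.bind hp (Partrec.comp hq Computable.fst).to₂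
  refine h.dom_re.of_eq fun a => ?_
  simp [Part.assert]

theorem of_eq_computable {f g : α → β} (hf : Computable f) (hg : Computable g) :
    REPred fun a => f a = g a :=
  haveI := Encodable.decidableEqOfEncodable β
  ComputablePred.to_re
    ⟨fun _ => inferInstance, (Primrec.eq (α := β)).decide.to_comp.comp hf hg⟩

theorem of_lt_computable {f g : α → ℕ} (hf : Computable f) (hg : Computable g) :
    REPred fun a => f a < g a :=
  ComputablePred.to_re
    ⟨fun _ => inferInstance, Primrec.nat_lt.decide.to_comp.comp hf hg⟩

theorem of_primrecPred {p : α → Prop} (hp : PrimrecPred p) : REPred p := by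
  obtain ⟨h, hp⟩ := hp
  exact ComputablePred.to_re ⟨h, hp.to_comp⟩

theorem of_ne_computable [DecidableEq β] {f g : α → β} (hf : Computable f) (hg : Computable g) :
    REPred fun a => f a ≠ g a :=
  (of_primrecPred (Primrec.eq (α := β)).not).comp (hf.pair hg)

/-- A recursively enumerable predicate stays so under an unbounded existential quantifier. -/
theorem exists_right {p : α × β → Prop} (hp : REPred p) : REPred fun a => ∃ b, p (a, b) := by
  obtain ⟨c, hc⟩ := Nat.Partrec.Code.exists_code.1 hp
  have key : ∀ x : α × β, p x ↔ ∃ k y, y ∈ Nat.Partrec.Code.evaln k c (Encodable.encode x) := by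
    intro x
    have h1 : p x ↔ (Nat.Partrec.Code.eval c (Encodable.encode x)).Dom := by
      rw [hc]; simp [Part.assert]
    rw [h1, Part.dom_iff_mem, exists_comm]
    simp only [Nat.Partrec.Code.evaln_complete]
  -- Dovetailing: `N` codes a candidate witness together with a bound on the running time of its
  -- verification.
  have h : Computable₂ fun (a : α) (N : ℕ) => (Encodable.decode (α := β × ℕ) N).bind fun b =>
      Nat.Partrec.Code.evaln b.2 c (Encodable.encode (a, b.1)) := by
    refine (Primrec.option_bind (Primrec.decode.comp Primrec.snd) ?_).to_comp
    refine Nat.Partrec.Code.primrec_evaln.comp (((Primrec.snd.comp Primrec.snd).pair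
      (Primrec.const c)).pair (Primrec.encode.comp
        ((Primrec.fst.comp Primrec.fst).pair (Primrec.fst.comp Primrec.snd))))
  refine (Partrec.rfindOpt h).dom_re.of_eq fun a => ?_
  rw [Nat.rfindOpt_dom]
  constructor
  · rintro ⟨n, y, hy⟩
    obtain ⟨b, -, hb⟩ := Option.bind_eq_some_iff.1 hy
    exact ⟨b.1, (key _).2 ⟨b.2, y, hb⟩⟩
  · rintro ⟨b, hb⟩
    obtain ⟨k, y, hy⟩ := (key _).1 hb
    exact ⟨Encodable.encode (b, k), y, by simpa using hy⟩

theorem or {p q : α → Prop} (hp : REPred p) (hq : REPred q) : REPred fun a => p a ∨ q a := by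
  -- Both semi-decisions run in parallel; they can only return `()`, so their outputs never
  -- conflict.
  obtain ⟨k, hk, H⟩ := Partrec.merge hp hq (by intros; rfl)
  refine hk.dom_re.of_eq fun a => ?_
  rw [Part.dom_iff_mem]
  simp [H]

/-- The finitely many semi-decisions are run one after another; the chain halts iff each of them
does. -/
theorem forall_lt {p : α × ℕ → Prop} (hp : REPred p) {n : α → ℕ} (hn : Computable n) :
    REPred fun a => ∀ i < n a, p (a, i) := by
  have h : Partrec fun a => (n a).rec (motive := fun _ => Part Unit) (Part.some ())
      fun y IH => IH.bind fun _ => Part.assert (p (a, y)) fun _ => Part.some () :=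
    Partrec.nat_rec hn (Computable.const ()).partrec
      ((Partrec.comp hp (Computable.fst.pair (Computable.fst.comp Computable.snd))).to₂)
  refine h.dom_re.of_eq fun a => ?_
  induction n a with
  | zero => simp
  | succ k ih =>
    simp only [Part.assert, Part.bind_dom] at ih ⊢
    rw [Nat.forall_lt_succ_right]
    exact ⟨fun ⟨h, h', _⟩ => ⟨ih.1 h, h'⟩, fun ⟨h, h'⟩ => ⟨ih.2 h, h', trivial⟩⟩

end REPred

/-! ### Computability of list operations and powers. -/

theorem Computable.list_flatMap_range {α β : Type*} [Primcodable α] [Primcodable β] {n : α → ℕ}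
    {f : α → ℕ → List β} (hn : Computable n) (hf : Computable fun x : α × ℕ => f x.1 x.2) :
    Computable fun a => (List.range (n a)).flatMap (f a) := by
  have h : Computable fun a => (n a).rec (motive := fun _ => List β) []
      fun y IH => IH ++ f a y :=
    Computable.nat_rec hn (Computable.const []) (Computable.to₂ <| Computable.list_append.comp
      (Computable.snd.comp Computable.snd)
      (hf.comp (Computable.fst.pair (Computable.fst.comp Computable.snd))))
  refine h.of_eq fun a => ?_
  induction n a with
  | zero => rfl
  | succ k ih => simp [List.range_succ, ih]

theorem Primrec.nat_list_sum : Primrec (List.sum : List ℕ → ℕ) :=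
  Primrec.list_foldr .id (.const 0)
    (Primrec.nat_add.comp (Primrec.fst.comp .snd) (Primrec.snd.comp .snd)).to₂

theorem Primrec.nat_pow : Primrec₂ ((· ^ ·) : ℕ → ℕ → ℕ) := by
  have h : Primrec fun a : ℕ × ℕ => a.2.rec (motive := fun _ => ℕ) 1 fun _ IH => IH * a.1 :=
    Primrec.nat_rec' .snd (.const 1)
      (Primrec.nat_mul.comp (Primrec.snd.comp .snd) (Primrec.fst.comp .fst)).to₂
  refine Primrec.of_eq h fun a => ?_
  obtain ⟨a, n⟩ := a
  induction n with
  | zero => rfl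
  | succ k ih => exact congrArg (· * a) ih

/-! ### Linear inequalities over a cube and their discretisation. -/

/-- A homogeneous linear form with integer coefficients in variables indexed by `W`: an entry
`(p, q, w)` stands for the term `(p - q) * w`. -/
abbrev LinForm (W : Type*) : Type _ := List (ℕ × ℕ × W)

namespace LinForm

/-- The value of a linear form at a point. -/
def eval {W : Type*} (φ : W → ℝ) (l : LinForm W) : ℝ :=
  (l.map fun t => ((t.1 : ℝ) - t.2.1) * φ t.2.2).sum

section

variable {W : Type*} (φ : W → ℝ)

@[simp] theorem eval_nil : eval φ [] = 0 := rfl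

@[simp] theorem eval_cons (t : ℕ × ℕ × W) (l : LinForm W) :
    eval φ (t :: l) = ((t.1 : ℝ) - t.2.1) * φ t.2.2 + eval φ l := by
  simp [eval]

@[simp] theorem eval_append (l l' : LinForm W) :
    eval φ (l ++ l') = eval φ l + eval φ l' := by
  simp [eval]

theorem eval_flatMap {ι : Type*} (s : List ι) (f : ι → LinForm W) :
    eval φ (s.flatMap f) = (s.map fun i => eval φ (f i)).sum := by
  induction s with
  | nil => rfl
  | cons a s ih => simp [ih]

theorem eval_flatMap_range (n : ℕ) (f : ℕ → LinForm W) :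
    eval φ ((List.range n).flatMap f) = ∑ i : Fin n, eval φ (f i) := by
  induction n with
  | zero => rfl
  | succ n ih => simp [List.range_succ, ih, Fin.sum_univ_castSucc]

end

/-- The `i`-th digit of `c` in base `2 * N + 1`. -/
def digit (N c i : ℕ) : ℕ := c / (2 * N + 1) ^ i % (2 * N + 1)

theorem digit_le (N c i : ℕ) : digit N c i ≤ 2 * N :=
  Nat.lt_succ_iff.1 (Nat.mod_lt _ (Nat.succ_pos _))

/-- Coding a whole grid point by one number turns the search over the grid into a bounded
quantifier. The base `2 * N + 1` counts the multiples of `1 / N` in `[-1, 1]`. -/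
theorem exists_digit_eq (N K : ℕ) (f : ℕ → ℕ) (hf : ∀ i, f i ≤ 2 * N) :
    ∃ c < (2 * N + 1) ^ K, ∀ i < K, digit N c i = f i := by
  let g : Fin K → Fin (2 * N + 1) := fun i => ⟨f i, Nat.lt_succ_of_le (hf i)⟩
  refine ⟨finFunctionFinEquiv g, (finFunctionFinEquiv g).2, fun i hi => ?_⟩
  have h := congrFun (finFunctionFinEquiv.symm_apply_apply g) ⟨i, hi⟩
  exact congrArg Fin.val h

variable {W : Type*} [Primcodable W]

/-- The grid point with code `x.2` and mesh `1 / x.1` violates the inequality `l.1 ≤ l.2` by more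
than the rounding error, and the variables that occur in `l.2` have codes below `x.1`. -/
def Violated (l : ℕ × LinForm W) (x : ℕ × ℕ) : Prop :=
  (∀ t ∈ l.2, Encodable.encode t.2.2 < x.1) ∧
    (l.2.map fun t => t.1 * digit x.1 x.2 (Encodable.encode t.2.2) + t.2.1 * x.1 + t.1 + t.2.1).sum <
      (l.2.map fun t => t.2.1 * digit x.1 x.2 (Encodable.encode t.2.2) + t.1 * x.1).sum +
        l.1 * x.1

theorem re_violated : REPred fun x : (ℕ × LinForm W) × ℕ × ℕ => Violated x.1 x.2 := by
  have hp : Primrec fun x : ((ℕ × LinForm W) × ℕ × ℕ) × ℕ × ℕ × W => x.2.1 := Primrec.fst.comp .snd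
  have hq : Primrec fun x : ((ℕ × LinForm W) × ℕ × ℕ) × ℕ × ℕ × W => x.2.2.1 :=
    Primrec.fst.comp (Primrec.snd.comp .snd)
  have hw : Primrec fun x : ((ℕ × LinForm W) × ℕ × ℕ) × ℕ × ℕ × W => Encodable.encode x.2.2.2 :=
    Primrec.encode.comp (Primrec.snd.comp (Primrec.snd.comp .snd))
  have hN : Primrec fun x : ((ℕ × LinForm W) × ℕ × ℕ) × ℕ × ℕ × W => x.1.2.1 :=
    Primrec.fst.comp (Primrec.snd.comp .fst)
  have hc : Primrec fun x : ((ℕ × LinForm W) × ℕ × ℕ) × ℕ × ℕ × W => x.1.2.2 :=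
    Primrec.snd.comp (Primrec.snd.comp .fst)
  have hB := Primrec.succ.comp (Primrec.nat_mul.comp (.const 2) hN)
  have hd : Primrec fun x : ((ℕ × LinForm W) × ℕ × ℕ) × ℕ × ℕ × W =>
      digit x.1.2.1 x.1.2.2 (Encodable.encode x.2.2.2) :=
    Primrec.nat_mod.comp (Primrec.nat_div.comp hc (Primrec.nat_pow.comp hB hw)) hB
  refine REPred.and (REPred.of_primrecPred ?_) (REPred.of_lt_computable
    (Primrec.nat_list_sum.comp (Primrec.list_map (Primrec.snd.comp .fst) (Primrec.nat_add.comp (Primrec.nat_add.comp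
      (Primrec.nat_add.comp (Primrec.nat_mul.comp hp hd) (Primrec.nat_mul.comp hq hN)) hp)
        hq).to₂)).to_comp
    (Primrec.nat_add.comp (Primrec.nat_list_sum.comp (Primrec.list_map (Primrec.snd.comp .fst)
      (Primrec.nat_add.comp (Primrec.nat_mul.comp hq hd) (Primrec.nat_mul.comp hp hN)).to₂))
      (Primrec.nat_mul.comp (Primrec.fst.comp .fst) (Primrec.fst.comp .snd))).to_comp)
  have hR : PrimrecRel fun (t : ℕ × ℕ × W) (N : ℕ) => Encodable.encode t.2.2 < N :=
    Primrec.nat_lt.comp (Primrec.encode.comp (Primrec.snd.comp (Primrec.snd.comp .fst))) .snd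
  exact hR.forall_mem_list.comp (Primrec.snd.comp .fst) (Primrec.fst.comp .snd)

/-- The digit `d` stands for the coordinate `(d - N) / N`. `Violated` moves negative terms across
the inequality to stay in `ℕ`; the summand `p + q` of each term `(p - q) * w` is the allowance for
rounding `w`. -/
theorem violated_iff (k : ℕ) (l : LinForm W) (N c : ℕ) : Violated (k, l) (N, c) ↔
    (∀ t ∈ l, Encodable.encode t.2.2 < N) ∧
    (l.map fun t => ((t.1 : ℝ) - t.2.1) * ((digit N c (Encodable.encode t.2.2) : ℝ) - N)
      + (t.1 + t.2.1)).sum < k * N := by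
  refine and_congr_right fun h => ?_
  clear h
  rw [← Nat.cast_lt (α := ℝ), Nat.cast_add, Nat.cast_mul, ← sub_lt_iff_lt_add']
  refine iff_of_eq (congrArg (· < (k * N : ℝ)) ?_)
  induction l with
  | nil => simp
  | cons t l ih =>
    simp only [List.map_cons, List.sum_cons, Nat.cast_add] at ih ⊢
    rw [← ih]
    push_cast
    ring

/-- Feasibility of the system of inequalities `l.1 ≤ l.2`, `l ∈ S`, over the cube `[-1, 1] ^ W`. -/
def Feasible (S : Set (ℕ × LinForm W)) : Prop :=
  ∃ φ : W → ℝ, (∀ w, |φ w| ≤ 1) ∧ ∀ l ∈ S, (l.1 : ℝ) ≤ eval φ l.2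

theorem Feasible.exists_not_violated {S : Set (ℕ × LinForm W)} (h : Feasible S) (N : ℕ) :
    ∃ c < (2 * N + 1) ^ N, ∀ l ∈ S, ¬ Violated l (N, c) := by
  obtain ⟨φ, hφ, hS⟩ := h
  have hb : ∀ w, 0 ≤ (φ w + 1) * N ∧ (φ w + 1) * N ≤ 2 * N := fun w => by
    have := abs_le.1 (hφ w)
    have hN : (0 : ℝ) ≤ N := Nat.cast_nonneg _
    exact ⟨mul_nonneg (by linarith) hN, mul_le_mul_of_nonneg_right (by linarith) hN⟩
  obtain ⟨c, hc, hd⟩ := exists_digit_eq N N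
    -- A feasible point is rounded down to the grid; numbers that code no variable get the
    -- irrelevant digit 0.
    (fun i => ((Encodable.decode (α := W) i).elim 0 fun w => ⌊(φ w + 1) * N⌋₊)) (by
      intro i
      cases Encodable.decode (α := W) i with
      | none => simp
      | some w => exact Nat.floor_le_of_le (by exact_mod_cast (hb w).2))
  refine ⟨c, hc, fun ⟨k, l⟩ hl hv => ?_⟩
  rw [violated_iff] at hv
  refine absurd hv.2 (not_lt.2 ?_)
  rw [mul_comm]
  refine (mul_le_mul_of_nonneg_left (hS _ hl) (Nat.cast_nonneg N)).trans ?_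
  rw [eval, ← List.sum_map_mul_left]
  refine List.sum_le_sum fun t ht => ?_
  rw [hd _ (hv.1 t ht), Encodable.encodek]
  simp only [Option.elim_some]
  have h1 := Nat.floor_le (hb t.2.2).1
  have h2 := Nat.lt_floor_add_one ((φ t.2.2 + 1) * N)
  have hp : (0 : ℝ) ≤ t.1 := Nat.cast_nonneg _
  have hq : (0 : ℝ) ≤ t.2.1 := Nat.cast_nonneg _
  generalize (⌊(φ t.2.2 + 1) * N⌋₊ : ℝ) = d at *
  -- Rounding moves the digit by less than 1, hence the term by at most `|p - q| ≤ p + q`.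
  nlinarith

/-- A limit of unviolated grid points is feasible: at mesh `1 / N` a fixed inequality can fail only
by a constant over `N`. -/
theorem Feasible.of_not_violated {S : Set (ℕ × LinForm W)}
    (h : ∀ N, ∃ c < (2 * N + 1) ^ N, ∀ l ∈ S, ¬ Violated l (N, c)) : Feasible S := by
  choose c _ hc using h
  -- The shift to `N + 1` avoids dividing by 0.
  let ψ : ℕ → W → ℝ := fun N w =>
    ((digit (N + 1) (c (N + 1)) (Encodable.encode w) : ℝ) - ((N + 1 : ℕ) : ℝ)) / ((N + 1 : ℕ) : ℝ)
  have hpos : ∀ N : ℕ, (0 : ℝ) < ((N + 1 : ℕ) : ℝ) := fun N => by positivity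
  have hψ : ∀ N, ψ N ∈ Set.pi Set.univ fun _ : W => Set.Icc (-1 : ℝ) 1 := by
    intro N w _
    have h1 : (digit (N + 1) (c (N + 1)) (Encodable.encode w) : ℝ) ≤ 2 * ((N + 1 : ℕ) : ℝ) := by
      exact_mod_cast digit_le _ _ _
    have h2 : (0 : ℝ) ≤ digit (N + 1) (c (N + 1)) (Encodable.encode w) := Nat.cast_nonneg _
    constructor
    · rw [le_div_iff₀ (hpos N)]; linarith
    · rw [div_le_iff₀ (hpos N)]; linarith
  -- There are countably many variables, so the compact cube is sequentially compact.
  obtain ⟨φ, hφ, u, hu, hlim⟩ :=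
    (isCompact_univ_pi fun _ : W => isCompact_Icc (a := (-1 : ℝ)) (b := 1)).tendsto_subseq hψ
  refine ⟨φ, fun w => abs_le.2 (hφ w trivial), fun ⟨k₀, l⟩ hl => ?_⟩
  have hev : Filter.Tendsto (fun k => eval (ψ (u k)) l) Filter.atTop (nhds (eval φ l)) := by
    have hcont : Continuous fun φ : W → ℝ => eval φ l :=
      continuous_list_sum l fun t _ => continuous_const.mul (continuous_apply _)
    exact (hcont.tendsto φ).comp hlim
  have hslack : Filter.Tendsto
      (fun k => (k₀ : ℝ) - (l.map fun t => ((t.1 : ℝ) + t.2.1)).sum / ((u k + 1 : ℕ) : ℝ))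
      Filter.atTop (nhds k₀) := by
    have := ((tendsto_const_div_atTop_nhds_zero_nat
      (l.map fun t => ((t.1 : ℝ) + t.2.1)).sum).comp (Filter.tendsto_add_atTop_nat 1)).comp
      hu.tendsto_atTop
    have h0 := (tendsto_const_nhds (x := (k₀ : ℝ))).sub this
    rw [sub_zero] at h0
    exact h0
  -- Once the mesh parameter exceeds all codes of variables in `l`, non-violation really bounds `l`.
  obtain ⟨M, hM⟩ : ∃ M, ∀ t ∈ l, Encodable.encode t.2.2 < M := by
    obtain ⟨M, hM⟩ := (l.map fun t => Encodable.encode t.2.2).toFinset.exists_nat_subset_range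
    exact ⟨M, fun t ht => by
      simpa using hM (List.mem_toFinset.2 (List.mem_map_of_mem ht))⟩
  refine le_of_tendsto_of_tendsto hslack hev ?_
  filter_upwards [Filter.eventually_ge_atTop M] with k hk
  have hnv := hc (u k + 1) _ hl
  rw [violated_iff, not_and, not_lt] at hnv
  have := hnv fun t ht => (hM t ht).trans_le
    ((hk.trans (hu.id_le k)).trans (Nat.le_succ _))
  have he : (l.map fun t => ((t.1 : ℝ) - t.2.1) *
      ((digit (u k + 1) (c (u k + 1)) (Encodable.encode t.2.2) : ℝ) - ((u k + 1 : ℕ) : ℝ))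
      + (t.1 + t.2.1)).sum = ((u k + 1 : ℕ) : ℝ) * eval (ψ (u k)) l +
      (l.map fun t => ((t.1 : ℝ) + t.2.1)).sum := by
    rw [List.sum_map_add, eval, ← List.sum_map_mul_left]
    congr 3
    funext t
    have := (hpos (u k)).ne'
    simp only [ψ]
    field_simp
  rw [he] at this
  rw [sub_le_iff_le_add]
  have h3 := div_le_div_of_nonneg_right this (hpos (u k)).le
  rwa [add_div, mul_div_cancel_left₀ _ (hpos (u k)).ne', mul_div_cancel_right₀ _ (hpos (u k)).ne']
    at h3

/-- Infeasibility over a cube of a recursively enumerable system of linear inequalities is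
recursively enumerable. -/
theorem re_not_feasible {α : Type*} [Primcodable α] {S : α → Set (ℕ × LinForm W)}
    (hS : REPred fun x : α × ℕ × LinForm W => x.2 ∈ S x.1) :
    REPred fun a => ¬ Feasible (S a) := by
  have h1 : REPred fun x : (((α × ℕ) × ℕ) × ℕ × LinForm W) =>
      x.2 ∈ S x.1.1.1 ∧ Violated x.2 (x.1.1.2, x.1.2) :=
    REPred.and
      (REPred.comp hS (f := fun x : (((α × ℕ) × ℕ) × ℕ × LinForm W) => (x.1.1.1, x.2))
        ((Computable.fst.comp (Computable.fst.comp .fst)).pair .snd))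
      (REPred.comp re_violated
        (f := fun x : (((α × ℕ) × ℕ) × ℕ × LinForm W) => (x.2, x.1.1.2, x.1.2)) (Computable.pair .snd
        ((Computable.snd.comp (Computable.fst.comp .fst)).pair (Computable.snd.comp .fst))))
  have hN : Computable fun x : α × ℕ => 2 * x.2 + 1 :=
    (Primrec.succ.comp (Primrec.nat_mul.comp (.const 2) .snd)).to_comp
  -- Infeasibility has the form: for some `N`, every grid point `c < (2 * N + 1) ^ N` violates some
  -- member of `S a`.
  have h2 := (h1.exists_right.forall_lt (Primrec.nat_pow.to_comp.comp hN .snd)).exists_right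
  refine h2.of_eq fun a => ?_
  rw [← not_iff_not]
  push Not
  exact ⟨fun h => Feasible.of_not_violated (S := S a) h, fun h => h.exists_not_violated⟩

end LinForm

/-! ### The moment system of a game. -/

/-- Letters `(s, x, a)` stand for the projections `A x a` (for `s = false`) and `B x a` (for
`s = true`). -/
abbrev Letter : Type := Bool × ℕ × ℕ

/-- Words in the letters stand for products of projections. -/
abbrev Word : Type := List Letter

/-- The linear form `-l`. -/
def LinForm.neg {W : Type*} (l : LinForm W) : LinForm W := l.map fun t => (t.2.1, t.1, t.2.2)

/-- Numerical data describing a game: the numbers of questions and answers, the decision function,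
and approximations `q v w k / 2 ^ k` of the probabilities of the questions. -/
structure GameData where
  n : ℕ
  m : ℕ
  D : ℕ → ℕ → ℕ → ℕ → Bool
  q : ℕ → ℕ → ℕ → ℕ

namespace GameData

/-- The form `w - w'`. -/
def subForm (w w' : Word) : LinForm Word := [(1, 0, w), (0, 1, w')]

/-- The form expressing that the letters `(s, x, a)` with `a < m` sum to `1`. -/
def pvmForm (m : ℕ) (t : Bool × ℕ) (u v : Word) : LinForm Word :=
  ((List.range m).flatMap fun a => [(1, 0, u ++ (t.1, t.2, a) :: v)]) ++ [(0, 1, u ++ v)]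

/-- The form `c⋆ c`. -/
def gramForm (c : LinForm Word) : LinForm Word :=
  c.flatMap fun s => c.map fun t =>
    -- The coefficient is `(p - q) * (p' - q')` split into its positive and negative products;
    -- reversing a word is taking the adjoint, as letters are self-adjoint.
    (s.1 * t.1 + s.2.1 * t.2.1, s.1 * t.2.1 + s.2.1 * t.1, s.2.2.reverse ++ t.2.2)

/-- The contribution of the answers `i`, `j` to the questions `v`, `w` to the form `winForm`. -/
def winTerm (E : GameData) (b k v w i j : ℕ) : LinForm Word :=
  bif E.D v w i j then
    -- The constant term compensates the error of the approximate probability, which is at most 1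
    -- after scaling by `2 ^ k`.
    [((b + 1) * E.q v w k, 0, [(false, v, i), (true, w, j)]), (b + 1, 0, [])]
  else []

/-- The form expressing that the winning probability computed from the `k`-th approximation of the
distribution of the questions is at least `a / (b + 1)`, up to the approximation error. -/
def winForm (E : GameData) (a b k : ℕ) : LinForm Word :=
  ((List.range E.n).flatMap fun v => (List.range E.n).flatMap fun w =>
    (List.range E.m).flatMap fun i => (List.range E.m).flatMap fun j => E.winTerm b k v w i j) ++ [(0, a * 2 ^ k, [])]

/-- The linear relations between moments of a synchronous strategy. -/
def IsRelation (E : GameData) (l : LinForm Word) : Prop :=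
  (∃ p : Word × Letter × Word,
    l = subForm (p.1 ++ p.2.1 :: p.2.1 :: p.2.2) (p.1 ++ p.2.1 :: p.2.2)) ∨
  (∃ p : Word × (ℕ × ℕ) × (ℕ × ℕ) × Word,
    l = subForm (p.1 ++ (false, p.2.1) :: (true, p.2.2.1) :: p.2.2.2)
      (p.1 ++ (true, p.2.2.1) :: (false, p.2.1) :: p.2.2.2)) ∨
  -- A moment and its adjoint are complex conjugates, so their real parts agree.
  (∃ w : Word, l = subForm w.reverse w) ∨
  (∃ p : (Bool × ℕ) × Word × Word, p.1.2 < E.n ∧ l = pvmForm E.m p.1 p.2.1 p.2.2) ∨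
  (∃ p : ℕ × ℕ × ℕ, p.2.1 ≠ p.2.2 ∧ l = [(1, 0, [(false, p.1, p.2.1), (true, p.1, p.2.2)])])

/-- The inequalities for the moments of synchronous strategies with winning probability at least
`a / (b + 1)`. -/
def system (E : GameData) (a b : ℕ) : Set (ℕ × LinForm Word) :=
  -- Together with the cube bound, `1 ≤ φ []` forces `φ [] = 1`. Each relation is imposed with both
  -- signs, hence as an equality.
  {x | x = (1, [(1, 0, [])]) ∨ x.1 = 0 ∧ (E.IsRelation x.2 ∨ E.IsRelation x.2.neg ∨
    (∃ c, x.2 = gramForm c) ∨ ∃ k, x.2 = E.winForm a b k)}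

/-! ### Effectivity of the moment system. -/

section Computability

variable {α : Type*} [Primcodable α]

theorem computable_subForm {f g : α → Word} (hf : Computable f) (hg : Computable g) :
    Computable fun x => subForm (f x) (g x) :=
  Computable.list_cons.comp ((Computable.const 1).pair ((Computable.const 0).pair hf))
    (Computable.list_cons.comp ((Computable.const 0).pair ((Computable.const 1).pair hg))
      (Computable.const []))

theorem computable_pvmForm {m : α → ℕ} {t : α → Bool × ℕ} {u v : α → Word} (hm : Computable m)
    (ht : Computable t) (hu : Computable u) (hv : Computable v) :
    Computable fun x => pvmForm (m x) (t x) (u x) (v x) := by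
  refine Computable.list_append.comp (Computable.list_flatMap_range hm
    (f := fun x a => [(1, 0, u x ++ ((t x).1, (t x).2, a) :: v x)]) ?_)
    (Computable.list_cons.comp ((Computable.const 0).pair ((Computable.const 1).pair
      (Computable.list_append.comp hu hv))) (Computable.const []))
  exact Computable.list_cons.comp ((Computable.const 1).pair ((Computable.const 0).pair
    (Computable.list_append.comp (hu.comp .fst) (Computable.list_cons.comp
      ((Computable.fst.comp (ht.comp .fst)).pair
        ((Computable.snd.comp (ht.comp .fst)).pair .snd)) (hv.comp .fst))))) (Computable.const [])

theorem primrec_gramForm : Primrec gramForm := by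
  refine Primrec.list_flatMap .id (Primrec.list_map .fst ?_)
  have s : Primrec fun x : (LinForm Word × ℕ × ℕ × Word) × ℕ × ℕ × Word => x.1.2 :=
    Primrec.snd.comp .fst
  have t : Primrec fun x : (LinForm Word × ℕ × ℕ × Word) × ℕ × ℕ × Word => x.2 := .snd
  have s1 := Primrec.fst.comp s
  have s2 := Primrec.fst.comp (Primrec.snd.comp s)
  have t1 := Primrec.fst.comp t
  have t2 := Primrec.fst.comp (Primrec.snd.comp t)
  exact (Primrec.nat_add.comp (Primrec.nat_mul.comp s1 t1) (Primrec.nat_mul.comp s2 t2)).pair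
    ((Primrec.nat_add.comp (Primrec.nat_mul.comp s1 t2) (Primrec.nat_mul.comp s2 t1)).pair
      (Primrec.list_append.comp (Primrec.list_reverse.comp (Primrec.snd.comp (Primrec.snd.comp s)))
        (Primrec.snd.comp (Primrec.snd.comp t))))

theorem primrec_neg : Primrec (LinForm.neg : LinForm Word → LinForm Word) :=
  Primrec.list_map .id ((Primrec.fst.comp (Primrec.snd.comp .snd)).pair
    ((Primrec.fst.comp .snd).pair (Primrec.snd.comp (Primrec.snd.comp .snd)))).to₂

variable {E : α → GameData} (hn : Computable fun z => (E z).n) (hm : Computable fun z => (E z).m)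
  (hD : Computable fun x : α × ℕ × ℕ × ℕ × ℕ =>
    (E x.1).D x.2.1 x.2.2.1 x.2.2.2.1 x.2.2.2.2)
  (hq : Computable fun x : α × ℕ × ℕ × ℕ => (E x.1).q x.2.1 x.2.2.1 x.2.2.2)

include hD hq in
theorem computable_winTerm {β : Type*} [Primcodable β] {z : β → α} {b k v w i j : β → ℕ}
    (hz : Computable z) (hb : Computable b) (hk : Computable k) (hv : Computable v)
    (hw : Computable w) (hi : Computable i) (hj : Computable j) :
    Computable fun y => (E (z y)).winTerm (b y) (k y) (v y) (w y) (i y) (j y) := by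
  have hb' : Computable fun y => b y + 1 := Computable.succ.comp hb
  have hD' : Computable fun y => (E (z y)).D (v y) (w y) (i y) (j y) :=
    hD.comp (hz.pair (hv.pair (hw.pair (hi.pair hj))))
  have hq' : Computable fun y => (E (z y)).q (v y) (w y) (k y) :=
    hq.comp (hz.pair (hv.pair (hw.pair hk)))
  have h1 : Computable fun y => (b y + 1) * (E (z y)).q (v y) (w y) (k y) :=
    Primrec.nat_mul.to_comp.comp hb' hq'
  have h2 : Computable fun y => ([(false, v y, i y), (true, w y, j y)] : Word) :=
    Computable.list_cons.comp ((Computable.const false).pair (hv.pair hi))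
      (Computable.list_cons.comp ((Computable.const true).pair (hw.pair hj)) (Computable.const []))
  exact Computable.cond hD' (Computable.list_cons.comp (h1.pair ((Computable.const 0).pair h2))
    (Computable.list_cons.comp (hb'.pair (Computable.const (0, []))) (Computable.const [])))
    (Computable.const [])

include hn hm hD hq in
theorem computable_winForm {β : Type*} [Primcodable β] {z : β → α} {a b k : β → ℕ}
    (hz : Computable z) (ha : Computable a) (hb : Computable b) (hk : Computable k) :
    Computable fun y => (E (z y)).winForm (a y) (b y) (k y) := by
  have hn' : Computable fun y => (E (z y)).n := hn.comp hz
  have hm' : Computable fun y => (E (z y)).m := hm.comp hz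
  have h1 : Computable fun y => a y * 2 ^ k y :=
    Primrec.nat_mul.to_comp.comp ha (Primrec.nat_pow.to_comp.comp (Computable.const 2) hk)
  refine Computable.list_append.comp ?_ (Computable.list_cons.comp ((Computable.const 0).pair
    (h1.pair (Computable.const []))) (Computable.const []))
  refine Computable.list_flatMap_range hn' ?_
  refine Computable.list_flatMap_range (hn'.comp .fst) ?_
  refine Computable.list_flatMap_range (hm'.comp (Computable.fst.comp .fst)) ?_
  refine Computable.list_flatMap_range
    (hm'.comp (Computable.fst.comp (Computable.fst.comp .fst))) ?_
  have y : Computable fun x : (((β × ℕ) × ℕ) × ℕ) × ℕ => x.1.1.1.1 :=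
    Computable.fst.comp (Computable.fst.comp (Computable.fst.comp .fst))
  exact computable_winTerm hD hq (hz.comp y) (hb.comp y) (hk.comp y)
    (Computable.snd.comp (Computable.fst.comp (Computable.fst.comp .fst)))
    (Computable.snd.comp (Computable.fst.comp .fst)) (Computable.snd.comp .fst) .snd

include hn hm in
theorem re_isRelation : REPred fun x : α × LinForm Word => (E x.1).IsRelation x.2 := by
  have l {β : Type} [Primcodable β] : Computable fun x : (α × LinForm Word) × β => x.1.2 :=
    Computable.snd.comp .fst
  have z {β : Type} [Primcodable β] : Computable fun x : (α × LinForm Word) × β => x.1.1 :=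
    Computable.fst.comp .fst
  refine REPred.or ?_ (REPred.or ?_ (REPred.or ?_ (REPred.or ?_ ?_)))
  · refine REPred.exists_right (p := fun x : (α × LinForm Word) × Word × Letter × Word =>
      x.1.2 = subForm (x.2.1 ++ x.2.2.1 :: x.2.2.1 :: x.2.2.2) (x.2.1 ++ x.2.2.1 :: x.2.2.2))
      (REPred.of_eq_computable l (computable_subForm ?_ ?_))
    · have s : Computable fun x : (α × LinForm Word) × Word × Letter × Word => x.2.2.1 :=
        Computable.fst.comp (Computable.snd.comp .snd)
      exact Computable.list_append.comp (Computable.fst.comp .snd) (Computable.list_cons.comp s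
        (Computable.list_cons.comp s (Computable.snd.comp (Computable.snd.comp .snd))))
    · exact Computable.list_append.comp (Computable.fst.comp .snd) (Computable.list_cons.comp
        (Computable.fst.comp (Computable.snd.comp .snd))
        (Computable.snd.comp (Computable.snd.comp .snd)))
  · refine REPred.exists_right (p := fun x : (α × LinForm Word) × Word × (ℕ × ℕ) × (ℕ × ℕ) × Word =>
      x.1.2 = subForm (x.2.1 ++ (false, x.2.2.1) :: (true, x.2.2.2.1) :: x.2.2.2.2)
        (x.2.1 ++ (true, x.2.2.2.1) :: (false, x.2.2.1) :: x.2.2.2.2))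
      (REPred.of_eq_computable l ?_)
    have s : Computable fun x : (α × LinForm Word) × Word × (ℕ × ℕ) × (ℕ × ℕ) × Word =>
        ((false, x.2.2.1) : Letter) :=
      (Computable.const false).pair (Computable.fst.comp (Computable.snd.comp .snd))
    have t : Computable fun x : (α × LinForm Word) × Word × (ℕ × ℕ) × (ℕ × ℕ) × Word =>
        ((true, x.2.2.2.1) : Letter) :=
      (Computable.const true).pair
        (Computable.fst.comp (Computable.snd.comp (Computable.snd.comp .snd)))
    have v : Computable fun x : (α × LinForm Word) × Word × (ℕ × ℕ) × (ℕ × ℕ) × Word =>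
        x.2.2.2.2 := Computable.snd.comp (Computable.snd.comp (Computable.snd.comp .snd))
    exact computable_subForm
      (Computable.list_append.comp (Computable.fst.comp .snd) (Computable.list_cons.comp s
        (Computable.list_cons.comp t v)))
      (Computable.list_append.comp (Computable.fst.comp .snd) (Computable.list_cons.comp t
        (Computable.list_cons.comp s v)))
  · exact REPred.exists_right (p := fun x : (α × LinForm Word) × Word =>
      x.1.2 = subForm x.2.reverse x.2)
      (REPred.of_eq_computable l (computable_subForm (Computable.list_reverse.comp .snd) .snd))
  · exact REPred.exists_right (p := fun x : (α × LinForm Word) × (Bool × ℕ) × Word × Word =>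
      x.2.1.2 < (E x.1.1).n ∧ x.1.2 = pvmForm (E x.1.1).m x.2.1 x.2.2.1 x.2.2.2)
      (REPred.and (REPred.of_lt_computable (Computable.snd.comp (Computable.fst.comp .snd))
        (hn.comp z)) (REPred.of_eq_computable l (computable_pvmForm (hm.comp z)
          (Computable.fst.comp .snd) (Computable.fst.comp (Computable.snd.comp .snd))
          (Computable.snd.comp (Computable.snd.comp .snd)))))
  · have x : Computable fun x : (α × LinForm Word) × ℕ × ℕ × ℕ => x.2.1 := Computable.fst.comp .snd
    have a : Computable fun x : (α × LinForm Word) × ℕ × ℕ × ℕ => x.2.2.1 :=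
      Computable.fst.comp (Computable.snd.comp .snd)
    have b : Computable fun x : (α × LinForm Word) × ℕ × ℕ × ℕ => x.2.2.2 :=
      Computable.snd.comp (Computable.snd.comp .snd)
    refine REPred.exists_right (p := fun x : (α × LinForm Word) × ℕ × ℕ × ℕ =>
      x.2.2.1 ≠ x.2.2.2 ∧ x.1.2 = [(1, 0, [(false, x.2.1, x.2.2.1), (true, x.2.1, x.2.2.2)])])
      (REPred.and (REPred.of_ne_computable a b) (REPred.of_eq_computable l ?_))
    exact Computable.list_cons.comp ((Computable.const 1).pair ((Computable.const 0).pair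
      (Computable.list_cons.comp ((Computable.const false).pair (x.pair a))
        (Computable.list_cons.comp ((Computable.const true).pair (x.pair b))
          (Computable.const []))))) (Computable.const [])

include hn hm hD hq in
theorem re_system : REPred fun x : (α × ℕ × ℕ) × ℕ × LinForm Word =>
    x.2 ∈ (E x.1.1).system x.1.2.1 x.1.2.2 := by
  have z : Computable fun x : (α × ℕ × ℕ) × ℕ × LinForm Word => x.1.1 := Computable.fst.comp .fst
  have l : Computable fun x : (α × ℕ × ℕ) × ℕ × LinForm Word => x.2.2 := Computable.snd.comp .snd
  have l' {β : Type} [Primcodable β] :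
      Computable fun x : ((α × ℕ × ℕ) × ℕ × LinForm Word) × β => x.1.2.2 := l.comp .fst
  refine REPred.or (REPred.of_eq_computable .snd (Computable.const _)) (REPred.and
    (REPred.of_eq_computable (Computable.fst.comp .snd) (Computable.const 0))
    (REPred.or ((re_isRelation hn hm).comp (z.pair l)) (REPred.or
      ((re_isRelation hn hm).comp (z.pair (primrec_neg.to_comp.comp l))) (REPred.or ?_ ?_))))
  · exact REPred.exists_right (p := fun x : ((α × ℕ × ℕ) × ℕ × LinForm Word) × LinForm Word =>
      x.1.2.2 = gramForm x.2)
      (REPred.of_eq_computable l' (primrec_gramForm.to_comp.comp .snd))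
  · refine REPred.exists_right (p := fun x : ((α × ℕ × ℕ) × ℕ × LinForm Word) × ℕ =>
      x.1.2.2 = (E x.1.1.1).winForm x.1.1.2.1 x.1.1.2.2 x.2)
      (REPred.of_eq_computable l' ?_)
    have y : Computable fun x : ((α × ℕ × ℕ) × ℕ × LinForm Word) × ℕ => x.1.1 :=
      Computable.fst.comp .fst
    exact computable_winForm hn hm hD hq (z.comp .fst)
      (Computable.fst.comp (Computable.snd.comp y)) (Computable.snd.comp (Computable.snd.comp y))
      .snd

include hn hm hD hq in
theorem re_not_feasible : REPred fun x : α × ℕ × ℕ =>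
    ¬ LinForm.Feasible ((E x.1).system x.2.1 x.2.2) :=
  LinForm.re_not_feasible (S := fun x : α × ℕ × ℕ => (E x.1).system x.2.1 x.2.2)
    (re_system hn hm hD hq)

end Computability

end GameData

/-! ### Solutions of the system as moment functions. -/

open GameData

@[simp] theorem LinForm.eval_neg {W : Type*} (φ : W → ℝ) (l : LinForm W) :
    eval φ l.neg = -eval φ l := by
  induction l with
  | nil => simp [neg]
  | cons t l ih =>
    have h : neg (t :: l) = (t.2.1, t.1, t.2.2) :: neg l := rfl
    rw [h, eval_cons, ih, eval_cons]
    ring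

/-- The properties that characterize the moments `w ↦ ⟨w ξ, ξ⟩` of synchronous commuting strategies,
in the case of real moments. -/
structure IsSyncMoment (n m : ℕ) (φ : Word → ℝ) : Prop where
  one : φ [] = 1
  abs_le : ∀ w, |φ w| ≤ 1
  idem : ∀ u s v, φ (u ++ s :: s :: v) = φ (u ++ s :: v)
  comm : ∀ u x y v, φ (u ++ (false, x) :: (true, y) :: v) = φ (u ++ (true, y) :: (false, x) :: v)
  symm : ∀ w, φ w.reverse = φ w
  pvm : ∀ t : Bool × ℕ, t.2 < n → ∀ u v, ∑ a : Fin m, φ (u ++ (t.1, t.2, (a : ℕ)) :: v) = φ (u ++ v)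
  sync : ∀ x a b, a ≠ b → φ [(false, x, a), (true, x, b)] = 0
  gram : ∀ c : LinForm Word, 0 ≤ (gramForm c).eval φ

theorem eval_subForm (φ : Word → ℝ) (w w' : Word) : (subForm w w').eval φ = φ w - φ w' := by
  simp [subForm, sub_eq_add_neg]

theorem eval_pvmForm (φ : Word → ℝ) (m : ℕ) (t : Bool × ℕ) (u v : Word) :
    (pvmForm m t u v).eval φ = ∑ a : Fin m, φ (u ++ (t.1, t.2, (a : ℕ)) :: v) - φ (u ++ v) := by
  simp [pvmForm, LinForm.eval_flatMap_range, sub_eq_add_neg]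

theorem GameData.feasible_iff (E : GameData) (a b : ℕ) : LinForm.Feasible (E.system a b) ↔
    ∃ φ, IsSyncMoment E.n E.m φ ∧ ∀ k, 0 ≤ (E.winForm a b k).eval φ := by
  constructor
  · rintro ⟨φ, hφ, h⟩
    have hrel : ∀ l, E.IsRelation l → l.eval φ = 0 := by
      intro l hl
      have h1 := h (0, l) (Or.inr ⟨rfl, Or.inl hl⟩)
      have hnn : l.neg.neg = l := by simp [LinForm.neg, Function.comp_def]
      have h2 := h (0, l.neg) (Or.inr ⟨rfl, Or.inr (Or.inl (by rwa [hnn]))⟩)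
      simp only [LinForm.eval_neg, Nat.cast_zero] at h1 h2
      linarith
    refine ⟨φ, ⟨?_, hφ, fun u s v => ?_, fun u x y v => ?_, fun w => ?_, fun t ht u v => ?_,
      fun x a b hab => ?_, fun c => ?_⟩, fun k => ?_⟩
    · have h1 := h _ (Or.inl rfl)
      have h2 := (abs_le.1 (hφ [])).2
      simp at h1
      linarith
    · have := hrel _ (Or.inl ⟨(u, s, v), rfl⟩)
      rw [eval_subForm] at this
      exact sub_eq_zero.1 this
    · have := hrel _ (Or.inr (Or.inl ⟨(u, x, y, v), rfl⟩))
      rw [eval_subForm] at this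
      exact sub_eq_zero.1 this
    · have := hrel _ (Or.inr (Or.inr (Or.inl ⟨w, rfl⟩)))
      rw [eval_subForm] at this
      exact sub_eq_zero.1 this
    · have := hrel _ (Or.inr (Or.inr (Or.inr (Or.inl ⟨(t, u, v), ht, rfl⟩))))
      rw [eval_pvmForm] at this
      exact sub_eq_zero.1 this
    · have := hrel _ (Or.inr (Or.inr (Or.inr (Or.inr ⟨(x, a, b), hab, rfl⟩))))
      simpa using this
    · have := h (0, _) (Or.inr ⟨rfl, Or.inr (Or.inr (Or.inl ⟨c, rfl⟩))⟩)
      rwa [Nat.cast_zero] at this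
    · have := h (0, _) (Or.inr ⟨rfl, Or.inr (Or.inr (Or.inr ⟨k, rfl⟩))⟩)
      rwa [Nat.cast_zero] at this
  · rintro ⟨φ, hφ, hk⟩
    have hrel : ∀ l, E.IsRelation l → l.eval φ = 0 := by
      rintro l (⟨p, rfl⟩ | ⟨p, rfl⟩ | ⟨w, rfl⟩ | ⟨p, hp, rfl⟩ | ⟨p, hp, rfl⟩)
      · rw [eval_subForm, hφ.idem, sub_self]
      · rw [eval_subForm, hφ.comm, sub_self]
      · rw [eval_subForm, hφ.symm, sub_self]
      · rw [eval_pvmForm, hφ.pvm _ hp, sub_self]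
      · simp [hφ.sync _ _ _ hp]
    refine ⟨φ, hφ.abs_le, ?_⟩
    rintro ⟨k, l⟩ (h | ⟨h0, h | h | ⟨c, h⟩ | ⟨k, h⟩⟩)
    · obtain ⟨rfl, rfl⟩ := Prod.mk.inj h
      simp [hφ.one]
    all_goals dsimp only at h0 h ⊢; subst h0; rw [Nat.cast_zero]
    · exact (hrel l h).ge
    · have := hrel _ h
      rw [LinForm.eval_neg] at this
      linarith
    · rw [h]; exact hφ.gram c
    · rw [h]; exact hk k

/-- The numerical data of a game. -/
def NonlocalGame.data (G : NonlocalGame) (d : ℕ → ℕ → ℕ → ℕ → Bool) (q : ℕ → ℕ → ℕ → ℕ) :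
    GameData := ⟨G.n, G.m, d, q⟩

/-- The correlation given by a moment function. -/
def momentCorrelation (n m : ℕ) (φ : Word → ℝ) : Correlation n m :=
  fun i j v w => φ [(false, v, i), (true, w, j)]

/-- With `P` the winning probability, the form evaluates to at least `2 ^ k * ((b + 1) * P - a)` and
exceeds it by at most a constant independent of `k`. Nonnegativity for all `k` therefore means `a ≤
(b + 1) * P`. -/
theorem winForm_eval_nonneg_iff (G : NonlocalGame) {d : ℕ → ℕ → ℕ → ℕ → Bool} {q : ℕ → ℕ → ℕ → ℕ}
    (hd : ∀ (v w : Fin G.n) (i j : Fin G.m), d v w i j = G.D v w i j)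
    (hq : ∀ (v w : Fin G.n) (k : ℕ), |G.μ v w - (q v w k : ℝ) / 2 ^ k| ≤ 1 / 2 ^ k)
    {φ : Word → ℝ} (h1 : φ [] = 1) (hφ : ∀ w, |φ w| ≤ 1) (a b : ℕ) :
    (∀ k, 0 ≤ ((G.data d q).winForm a b k).eval φ) ↔
      (a : ℝ) / ((b : ℝ) + 1) ≤ G.winProb (momentCorrelation G.n G.m φ) := by
  -- `T v w` is the winning probability given the questions; `C v w` counts the accepted answer
  -- pairs and bounds `|T v w|`.
  set T : Fin G.n → Fin G.n → ℝ := fun v w => ∑ i : Fin G.m, ∑ j : Fin G.m,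
    (if G.D v w i j then (1 : ℝ) else 0) * φ [(false, v, i), (true, w, j)] with hT
  set C : Fin G.n → Fin G.n → ℝ := fun v w => ∑ i : Fin G.m, ∑ j : Fin G.m,
    (if G.D v w i j then (1 : ℝ) else 0) with hC
  have hTC : ∀ v w, |T v w| ≤ C v w := fun v w => by
    refine (Finset.abs_sum_le_sum_abs _ _).trans (Finset.sum_le_sum fun i _ => ?_)
    refine (Finset.abs_sum_le_sum_abs _ _).trans (Finset.sum_le_sum fun j _ => ?_)
    split_ifs
    · simpa using hφ _
    · simp
  have hwin : G.winProb (momentCorrelation G.n G.m φ) = ∑ v, ∑ w, G.μ v w * T v w := rfl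
  have heval : ∀ k, ((G.data d q).winForm a b k).eval φ =
      (b + 1) * ∑ v : Fin G.n, ∑ w : Fin G.n, (q v w k * T v w + C v w) - a * 2 ^ k := by
    intro k
    have hterm : ∀ (v w : Fin G.n) (i j : Fin G.m), ((G.data d q).winTerm b k v w i j).eval φ =
        (b + 1) * (q v w k * ((if G.D v w i j then (1 : ℝ) else 0) *
          φ [(false, v, i), (true, w, j)]) + (if G.D v w i j then (1 : ℝ) else 0)) := by
      intro v w i j
      simp only [winTerm, NonlocalGame.data, hd]
      cases G.D v w i j
      · simp
      · simp [h1]; ring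
    simp only [winForm, LinForm.eval_append, LinForm.eval_flatMap_range]
    rw [Finset.mul_sum, sub_eq_add_neg]
    congr 1
    · refine Finset.sum_congr rfl fun v _ => ?_
      rw [Finset.mul_sum]
      refine Finset.sum_congr rfl fun w _ => ?_
      rw [hT, hC, Finset.mul_sum, ← Finset.sum_add_distrib, Finset.mul_sum]
      refine Finset.sum_congr rfl fun i _ => ?_
      rw [Finset.mul_sum, ← Finset.sum_add_distrib, Finset.mul_sum]
      exact Finset.sum_congr rfl fun j _ => hterm v w i j
    · simp [h1]
  have hest : ∀ k v w, |2 ^ k * (G.μ v w * T v w) - q v w k * T v w| ≤ C v w := by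
    intro k v w
    have h2 : (0 : ℝ) < 2 ^ k := by positivity
    have h3 : |2 ^ k * G.μ v w - q v w k| ≤ 1 := by
      have := mul_le_mul_of_nonneg_left (hq v w k) h2.le
      rwa [← abs_of_pos h2, ← abs_mul, abs_of_pos h2, mul_sub, mul_div_cancel₀ _ h2.ne',
        mul_div_cancel₀ _ h2.ne'] at this
    rw [← mul_assoc, ← sub_mul, abs_mul]
    calc _ ≤ 1 * C v w := mul_le_mul h3 (hTC v w) (abs_nonneg _) zero_le_one
      _ = C v w := one_mul _
  have hlow : ∀ k, 2 ^ k * ∑ v, ∑ w, G.μ v w * T v w ≤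
      ∑ v : Fin G.n, ∑ w : Fin G.n, (q v w k * T v w + C v w) := fun k => by
    simp only [Finset.mul_sum]
    refine Finset.sum_le_sum fun v _ => Finset.sum_le_sum fun w _ => ?_
    linarith [(abs_le.1 (hest k v w)).2]
  have hupp : ∀ k, ∑ v : Fin G.n, ∑ w : Fin G.n, (q v w k * T v w + C v w) ≤
      2 ^ k * ∑ v, ∑ w, G.μ v w * T v w + 2 * ∑ v, ∑ w, C v w := fun k => by
    simp only [Finset.mul_sum, ← Finset.sum_add_distrib]
    refine Finset.sum_le_sum fun v _ => Finset.sum_le_sum fun w _ => ?_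
    linarith [(abs_le.1 (hest k v w)).1]
  rw [hwin]
  set P := ∑ v, ∑ w, G.μ v w * T v w
  have hb : (0 : ℝ) < b + 1 := by positivity
  constructor
  · intro h
    by_contra! hlt
    rw [lt_div_iff₀ hb] at hlt
    -- For this `k` the deficit `2 ^ k * (a - P * (b + 1))` exceeds the total error allowance.
    obtain ⟨k, hk⟩ := pow_unbounded_of_one_lt
      ((b + 1) * (2 * ∑ v, ∑ w, C v w) / (a - P * (b + 1))) one_lt_two
    rw [div_lt_iff₀ (sub_pos.2 hlt)] at hk
    have h2 := h k
    rw [heval] at h2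
    have h3 := mul_le_mul_of_nonneg_left (hupp k) hb.le
    linarith
  · intro h k
    rw [div_le_iff₀ hb] at h
    rw [heval]
    have h2 := mul_le_mul_of_nonneg_left (hlow k) hb.le
    have h3 := mul_le_mul_of_nonneg_left h (pow_nonneg zero_le_two k : (0 : ℝ) ≤ 2 ^ k)
    linarith

theorem eval_gramForm (φ : Word → ℝ) (c : LinForm Word) : (gramForm c).eval φ =
    (c.map fun s => (c.map fun t => ((s.1 : ℝ) - s.2.1) * (((t.1 : ℝ) - t.2.1) *
      φ (s.2.2.reverse ++ t.2.2))).sum).sum := by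
  rw [gramForm, LinForm.eval_flatMap]
  congr 2
  funext s
  rw [LinForm.eval, List.map_map]
  congr 2
  funext t
  simp only [Function.comp_apply]
  push_cast
  ring

/-! ### From strategies to moments. -/

section Strategy

variable {H : Type*} [NormedAddCommGroup H] [InnerProductSpace ℂ H]

theorem re_inner_list_sum {ι : Type*} (f : ι → H) (c c' : List ι) :
    (c.map fun s => (c'.map fun t => (inner ℂ (f s) (f t)).re).sum).sum =
      (inner ℂ (c.map f).sum (c'.map f).sum).re := by
  have h : ∀ u, (c'.map fun t => (inner ℂ u (f t)).re).sum = (inner ℂ u (c'.map f).sum).re := by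
    intro u
    induction c' with
    | nil => simp
    | cons t c' ih => simp [ih]
  simp only [h]
  induction c with
  | nil => simp
  | cons s c ih => simp [ih]

/-- The projections of a pair of families of measurements, indexed by letters, and extended by `0`
to the letters that occur in no measurement. -/
def letterOp {n m : ℕ} (A B : Fin n → Fin m → (H →L[ℂ] H)) (s : Letter) : H →L[ℂ] H :=
  if h : s.2.1 < n ∧ s.2.2 < m then (bif s.1 then B else A) ⟨s.2.1, h.1⟩ ⟨s.2.2, h.2⟩ else 0

theorem letterOp_apply {n m : ℕ} (A B : Fin n → Fin m → (H →L[ℂ] H)) (t : Bool) (x : Fin n)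
    (a : Fin m) : letterOp A B (t, x, a) = (bif t then B else A) x a :=
  dif_pos (⟨x.2, a.2⟩ : (x : ℕ) < n ∧ (a : ℕ) < m)

variable [CompleteSpace H]

theorem IsStarProjection.norm_apply_le {p : H →L[ℂ] H} (hp : IsStarProjection p) (v : H) :
    ‖p v‖ ≤ ‖v‖ :=
  (p.le_opNorm v).trans (mul_le_of_le_one_left (norm_nonneg v) hp.norm_le)

theorem norm_prod_apply_le {L : Letter → H →L[ℂ] H} (hL : ∀ s, IsStarProjection (L s)) (v : H)
    (w : Word) : ‖(w.map L).prod v‖ ≤ ‖v‖ := by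
  induction w with
  | nil => simp
  | cons s w ih =>
    rw [List.map_cons, List.prod_cons, mul_apply_eq_comp]
    exact ((hL s).norm_apply_le _).trans ih

theorem inner_prod_reverse {L : Letter → H →L[ℂ] H} (hL : ∀ s, IsStarProjection (L s)) (u v : H)
    (w : Word) : inner ℂ u ((w.reverse.map L).prod v) = inner ℂ ((w.map L).prod u) v := by
  induction w generalizing v with
  | nil => simp
  | cons s w ih =>
    rw [List.reverse_cons, List.map_append, List.prod_append, mul_apply_eq_comp, ih,
      List.map_cons, List.prod_cons, mul_apply_eq_comp]
    have := (hL s).isSelfAdjoint.isSymmetric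
    simpa using (this ((w.map L).prod u) v).symm

/-- Linear relations with real coefficients survive taking real parts. The Gram form evaluates to
the squared norm of a real combination of the vectors `w ξ`. -/
theorem isSyncMoment_of_strategy {n m : ℕ} {L : Letter → H →L[ℂ] H} {ξ : H}
    (hL : ∀ s, IsStarProjection (L s)) (hξ : ‖ξ‖ = 1)
    (hcomm : ∀ x y, L (false, x) * L (true, y) = L (true, y) * L (false, x))
    (hpvm : ∀ t : Bool × ℕ, t.2 < n → ∑ a : Fin m, L (t.1, t.2, (a : ℕ)) = 1)
    (hsync : ∀ x a b, a ≠ b → (inner ℂ ξ (L (false, x, a) (L (true, x, b) ξ))).re = 0) :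
    IsSyncMoment n m fun w => (inner ℂ ξ ((w.map L).prod ξ)).re where
  one := by simp [hξ]
  abs_le w := by
    refine (Complex.abs_re_le_norm _).trans ((norm_inner_le_norm _ _).trans ?_)
    rw [hξ, one_mul, ← hξ]
    exact norm_prod_apply_le hL ξ w
  idem u s v := by
    simp only [List.map_append, List.map_cons, List.prod_append, List.prod_cons]
    rw [← mul_assoc (L s) (L s), (hL s).isIdempotentElem.eq]
  comm u x y v := by
    simp only [List.map_append, List.map_cons, List.prod_append, List.prod_cons]
    rw [← mul_assoc (L (false, x)), hcomm, mul_assoc]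
  symm w := by
    rw [inner_prod_reverse hL, ← inner_conj_symm, Complex.conj_re]
  pvm t ht u v := by
    simp only [List.map_append, List.map_cons, List.prod_append, List.prod_cons]
    rw [← Complex.re_sum, ← inner_sum, ← sum_apply, ← Finset.mul_sum,
      ← Finset.sum_mul, hpvm t ht, one_mul]
  sync x a b hab := by simpa using hsync x a b hab
  gram c := by
    have h : ∀ s t : ℕ × ℕ × Word, ((s.1 : ℝ) - s.2.1) * (((t.1 : ℝ) - t.2.1) *
        (inner ℂ ξ (((s.2.2.reverse ++ t.2.2).map L).prod ξ)).re) =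
        (inner ℂ ((((s.1 : ℝ) - s.2.1 : ℝ) : ℂ) • (s.2.2.map L).prod ξ)
          ((((t.1 : ℝ) - t.2.1 : ℝ) : ℂ) • (t.2.2.map L).prod ξ)).re := by
      intro s t
      rw [List.map_append, List.prod_append, mul_apply_eq_comp, inner_prod_reverse hL,
        inner_smul_left, inner_smul_right, Complex.conj_ofReal, Complex.re_ofReal_mul,
        Complex.re_ofReal_mul]
    rw [eval_gramForm]
    simp only [h]
    rw [re_inner_list_sum fun t : ℕ × ℕ × Word =>
      (((t.1 : ℝ) - t.2.1 : ℝ) : ℂ) • (t.2.2.map L).prod ξ]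
    exact inner_self_nonneg (𝕜 := ℂ)

end Strategy

theorem feasible_of_mem_cqcSync (G : NonlocalGame) {d : ℕ → ℕ → ℕ → ℕ → Bool}
    {q : ℕ → ℕ → ℕ → ℕ} (hd : ∀ (v w : Fin G.n) (i j : Fin G.m), d v w i j = G.D v w i j)
    (hq : ∀ (v w : Fin G.n) (k : ℕ), |G.μ v w - (q v w k : ℝ) / 2 ^ k| ≤ 1 / 2 ^ k) {a b : ℕ}
    {p : Correlation G.n G.m} (hp : p ∈ CqcSync G.n G.m)
    (hab : (a : ℝ) / ((b : ℝ) + 1) ≤ G.winProb p) :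
    LinForm.Feasible ((G.data d q).system a b) := by
  obtain ⟨⟨H, _, _, _, _, A, B, ξ, hξ, hA, hB, hAB, hpe⟩, hs⟩ := hp
  have hpe' : ∀ i j v w, p i j v w = (inner ℂ ξ (A v i (B w j ξ))).re := fun i j v w => by
    rw [← hpe, Complex.ofReal_re]
  have hm : IsSyncMoment G.n G.m fun w => (inner ℂ ξ ((w.map (letterOp A B)).prod ξ)).re := by
    refine isSyncMoment_of_strategy ?_ hξ ?_ ?_ ?_
    · rintro ⟨t, x, a⟩
      by_cases h : x < G.n ∧ a < G.m
      · rw [letterOp, dif_pos h]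
        cases t
        · exact (hA _).1 _
        · exact (hB _).1 _
      · rw [letterOp, dif_neg h]
        exact IsStarProjection.zero _
    · rintro ⟨x, a⟩ ⟨y, b⟩
      by_cases h : x < G.n ∧ a < G.m
      · by_cases h' : y < G.n ∧ b < G.m
        · simp only [letterOp, dif_pos h, dif_pos h', cond_true, cond_false]
          exact hAB _ _ _ _
        · simp only [letterOp, dif_neg h', mul_zero, zero_mul]
      · simp only [letterOp, dif_neg h, mul_zero, zero_mul]
    · rintro ⟨t, x⟩ hx
      simp only [fun a => letterOp_apply A B t ⟨x, hx⟩ a]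
      cases t
      · exact (hA _).2
      · exact (hB _).2
    · intro x a b hab
      by_cases h : x < G.n ∧ a < G.m
      · by_cases h' : x < G.n ∧ b < G.m
        · simp only [letterOp, dif_pos h, dif_pos h', cond_true, cond_false]
          rw [← hpe']
          exact hs _ _ _ fun h => hab (congrArg Fin.val h)
        · simp [letterOp, dif_neg h']
      · simp [letterOp, dif_neg h]
  refine (GameData.feasible_iff _ a b).2 ⟨_, hm, ?_⟩
  rw [winForm_eval_nonneg_iff G hd hq hm.one hm.abs_le]
  convert hab using 2
  funext i j v w
  rw [hpe', momentCorrelation]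
  simp [letterOp_apply]

/-! ### From moments to strategies: the GNS construction. -/

theorem tendsto_int_floor_mul_natCast_div (x : ℝ) :
    Filter.Tendsto (fun k : ℕ => (⌊x * k⌋ : ℝ) / k) Filter.atTop (nhds x) := by
  have h1 : Filter.Tendsto (fun k : ℕ => x - 1 / (k : ℝ)) Filter.atTop (nhds x) := by
    simpa using tendsto_const_nhds.sub (tendsto_const_div_atTop_nhds_zero_nat (1 : ℝ))
  refine tendsto_of_tendsto_of_tendsto_of_le_of_le' h1 tendsto_const_nhds ?_ ?_
  all_goals
    filter_upwards [Filter.eventually_gt_atTop 0] with k hk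
    have hk' : (0 : ℝ) < k := Nat.cast_pos.2 hk
  · rw [le_div_iff₀ hk', sub_mul, one_div, inv_mul_cancel₀ hk'.ne']
    exact (Int.sub_one_lt_floor _).le
  · rw [div_le_iff₀ hk']
    exact Int.floor_le _

namespace IsSyncMoment

variable {n m : ℕ} {φ : Word → ℝ}

theorem int_gram_nonneg (h : IsSyncMoment n m φ) (s : Finset Word) (c : Word → ℤ) :
    0 ≤ ∑ u ∈ s, ∑ v ∈ s, (c u : ℝ) * (c v * φ (u.reverse ++ v)) := by
  have h1 := h.gram (s.toList.map fun w => ((c w).toNat, (-c w).toNat, w))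
  have hc : ∀ w, ((c w).toNat : ℝ) - ((-c w).toNat : ℝ) = c w := fun w => by
    have := Int.toNat_sub_toNat_neg (c w)
    exact_mod_cast this
  simpa only [eval_gramForm, List.map_map, Function.comp_def, hc, Finset.sum_map_toList] using h1

/-- Integer coefficients give rational ones by homogeneity, and `⌊c * k⌋ / k → c` gives real ones.
-/
theorem gram_nonneg (h : IsSyncMoment n m φ) (s : Finset Word) (c : Word → ℝ) :
    0 ≤ ∑ u ∈ s, ∑ v ∈ s, c u * (c v * φ (u.reverse ++ v)) := by
  have hlim : ∀ x : ℝ, Filter.Tendsto (fun k : ℕ => (⌊x * k⌋ : ℝ) / k) Filter.atTop (nhds x) :=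
    tendsto_int_floor_mul_natCast_div
  have : Filter.Tendsto (fun k : ℕ => ∑ u ∈ s, ∑ v ∈ s, (⌊c u * k⌋ : ℝ) / k *
      ((⌊c v * k⌋ : ℝ) / k * φ (u.reverse ++ v))) Filter.atTop
      (nhds (∑ u ∈ s, ∑ v ∈ s, c u * (c v * φ (u.reverse ++ v)))) :=
    tendsto_finsetSum _ fun u _ => tendsto_finsetSum _ fun v _ =>
      (hlim _).mul ((hlim _).mul tendsto_const_nhds)
  refine ge_of_tendsto' this fun k => ?_
  have h1 := mul_nonneg (h.int_gram_nonneg s fun w => ⌊c w * k⌋) (sq_nonneg ((k : ℝ)⁻¹))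
  simp only [Finset.sum_mul] at h1
  refine h1.trans_eq (Finset.sum_congr rfl fun u _ => Finset.sum_congr rfl fun v _ => ?_)
  ring

set_option linter.unusedVariables false in
/-- The free vector space on the words, with the positive semidefinite form given by the moments. -/
@[nolint unusedArguments]
def PreGNS (h : IsSyncMoment n m φ) : Type := Word →₀ ℂ

variable (h : IsSyncMoment n m φ)

noncomputable instance : AddCommGroup h.PreGNS := inferInstanceAs (AddCommGroup (Word →₀ ℂ))
noncomputable instance : Module ℂ h.PreGNS := inferInstanceAs (Module ℂ (Word →₀ ℂ))

/-- The sesquilinear form with matrix `φ (u.reverse ++ v)`. -/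
noncomputable def form (φ : Word → ℝ) (f g : Word →₀ ℂ) : ℂ :=
  f.sum fun u a => g.sum fun v b => star a * (b * (φ (u.reverse ++ v) : ℂ))

theorem conj_form (h : IsSyncMoment n m φ) (f g : Word →₀ ℂ) : star (form φ g f) = form φ f g := by
  simp only [form, Finsupp.sum, star_sum]
  rw [Finset.sum_comm]
  refine Finset.sum_congr rfl fun u _ => Finset.sum_congr rfl fun v _ => ?_
  rw [← h.symm, List.reverse_append, List.reverse_reverse]
  simp
  ring

/-- Since `φ` is real, the real part of the form at `f` is the sum of the real quadratic form at `re
f` and at `im f`. -/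
theorem form_self_nonneg (h : IsSyncMoment n m φ) (f : Word →₀ ℂ) : 0 ≤ (form φ f f).re := by
  have h1 := add_nonneg (h.gram_nonneg f.support fun w => (f w).re)
    (h.gram_nonneg f.support fun w => (f w).im)
  simp only [← Finset.sum_add_distrib] at h1
  simp only [form, Finsupp.sum, Complex.re_sum]
  refine h1.trans_eq (Finset.sum_congr rfl fun u _ => Finset.sum_congr rfl fun v _ => ?_)
  simp

/-- The semi-inner product on the free vector space on the words. -/
noncomputable abbrev core : PreInnerProductSpace.Core ℂ h.PreGNS where
  inner f g := form φ f g
  conj_inner_symm f g := conj_form h f g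
  re_inner_nonneg f := form_self_nonneg h f
  add_left f f' g := by
    refine Finsupp.sum_add_index' (fun u => ?_) fun u a b => ?_
    · simp [Finsupp.sum]
    · simp [Finsupp.sum, ← Finset.sum_add_distrib, add_mul]
  smul_left f g r := by
    refine (Finsupp.sum_smul_index fun u => ?_).trans ?_
    · simp [Finsupp.sum]
    · simp only [form, Finsupp.sum, Finset.mul_sum]
      simp [mul_assoc]

noncomputable instance : SeminormedAddCommGroup h.PreGNS :=
  InnerProductSpace.Core.toSeminormedAddCommGroup (c := h.core)

noncomputable instance : InnerProductSpace ℂ h.PreGNS := InnerProductSpace.ofCore h.core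

/-- The basis vector of a word. -/
noncomputable def preVec (w : Word) : h.PreGNS := Finsupp.single w (1 : ℂ)

theorem inner_preVec (u v : Word) :
    inner ℂ (h.preVec u) (h.preVec v) = (φ (u.reverse ++ v) : ℂ) := by
  have : form φ (Finsupp.single u 1) (Finsupp.single v 1) = (φ (u.reverse ++ v) : ℂ) := by
    simp [form]
  exact this

theorem preVec_induction {p : h.PreGNS → Prop} (h0 : p 0) (hadd : ∀ f g, p f → p g → p (f + g))
    (hsmul : ∀ (c : ℂ) w, p (c • h.preVec w)) (f : h.PreGNS) : p f := by
  refine Finsupp.induction_linear f h0 hadd fun w c => ?_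
  have hc : c • h.preVec w = (Finsupp.single w c : Word →₀ ℂ) := Finsupp.smul_single_one w c
  exact hc ▸ hsmul c w

/-- Left multiplication by a letter. -/
noncomputable def leftMul (s : Letter) : h.PreGNS →ₗ[ℂ] h.PreGNS :=
  Finsupp.lmapDomain ℂ ℂ (List.cons s)

theorem leftMul_preVec (s : Letter) (w : Word) : h.leftMul s (h.preVec w) = h.preVec (s :: w) :=
  Finsupp.mapDomain_single

theorem inner_leftMul (s : Letter) (f g : h.PreGNS) :
    inner ℂ (h.leftMul s f) g = inner ℂ f (h.leftMul s g) := by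
  induction f using h.preVec_induction with
  | h0 => simp
  | hadd f f' ih ih' => simp [inner_add_left, ih, ih']
  | hsmul c u =>
    induction g using h.preVec_induction with
    | h0 => simp
    | hadd g g' ih ih' => rw [map_add, inner_add_right, inner_add_right, ih, ih']
    | hsmul d v => simp [inner_smul_left, inner_smul_right, leftMul_preVec, inner_preVec]

/-- Left multiplication is idempotent only modulo null vectors of the form, so idempotence is
expressed by inner products. -/
theorem inner_leftMul_leftMul (s : Letter) (f g : h.PreGNS) :
    inner ℂ f (h.leftMul s (h.leftMul s g)) = inner ℂ f (h.leftMul s g) := by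
  induction f using h.preVec_induction with
  | h0 => simp
  | hadd f f' ih ih' => simp [inner_add_left, ih, ih']
  | hsmul c u =>
    induction g using h.preVec_induction with
    | h0 => simp
    | hadd g g' ih ih' => simp [inner_add_right, ih, ih']
    | hsmul d v => simp [inner_smul_left, inner_smul_right, leftMul_preVec, inner_preVec, h.idem]

/-- From `‖P f‖² = ⟨f, P f⟩ ≤ ‖f‖ ‖P f‖`. This contractivity lets `P` extend to the completion. -/
theorem norm_leftMul_le (s : Letter) (f : h.PreGNS) : ‖h.leftMul s f‖ ≤ ‖f‖ := by
  have h1 : ‖h.leftMul s f‖ * ‖h.leftMul s f‖ ≤ ‖f‖ * ‖h.leftMul s f‖ := by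
    rw [← inner_self_eq_norm_mul_norm (𝕜 := ℂ), inner_leftMul, inner_leftMul_leftMul]
    exact (Complex.re_le_norm _).trans (norm_inner_le_norm _ _)
  rcases (norm_nonneg (h.leftMul s f)).eq_or_lt with h0 | h0
  · rw [← h0]; exact norm_nonneg f
  · exact le_of_mul_le_mul_right h1 h0

instance : TopologicalSpace.SeparableSpace h.PreGNS := by
  rw [← TopologicalSpace.isSeparable_univ_iff]
  refine ((Set.countable_range h.preVec).isSeparable.span (R := ℂ)).mono fun f _ => ?_
  change f ∈ Submodule.span ℂ (Set.range h.preVec)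
  induction f using h.preVec_induction with
  | h0 => exact Submodule.zero_mem _
  | hadd f g hf hg => exact Submodule.add_mem _ (hf trivial) (hg trivial)
  | hsmul c w => exact Submodule.smul_mem _ c (Submodule.subset_span ⟨w, rfl⟩)

/-- The Hilbert space generated by the words. -/
abbrev GNS : Type := UniformSpace.Completion h.PreGNS

/-- The vector of a word. -/
noncomputable def vec (w : Word) : h.GNS := (h.preVec w : h.GNS)

theorem inner_vec (u v : Word) : inner ℂ (h.vec u) (h.vec v) = (φ (u.reverse ++ v) : ℂ) := by
  rw [vec, vec, UniformSpace.Completion.inner_coe, inner_preVec]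

theorem vec_induction {p : h.GNS → Prop} (hc : IsClosed {x | p x}) (h0 : p 0)
    (hadd : ∀ f g, p f → p g → p (f + g)) (hsmul : ∀ (c : ℂ) w, p (c • h.vec w)) (x : h.GNS) :
    p x := by
  induction x using UniformSpace.Completion.induction_on with
  | hp => exact hc
  | ih f =>
    induction f using h.preVec_induction with
    | h0 => exact h0
    | hadd f g hf hg => simpa [UniformSpace.Completion.coe_add] using hadd _ _ hf hg
    | hsmul c w => simpa [UniformSpace.Completion.coe_smul, vec] using hsmul c w

/-- Word vectors span a dense subspace, so operator identities on the GNS space reduce to identities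
between moments. -/
theorem clm_ext {S T : h.GNS →L[ℂ] h.GNS}
    (hST : ∀ u v, inner ℂ (h.vec u) (S (h.vec v)) = inner ℂ (h.vec u) (T (h.vec v))) : S = T := by
  ext x
  induction x using h.vec_induction with
  | hc => exact isClosed_eq S.continuous T.continuous
  | h0 => simp
  | hadd f g hf hg => simp [hf, hg]
  | hsmul c v =>
    rw [map_smul, map_smul]
    congr 1
    refine ext_inner_left ℂ fun y => ?_
    induction y using h.vec_induction with
    | hc => exact isClosed_eq (by fun_prop) (by fun_prop)
    | h0 => simp
    | hadd f g hf hg => simp [inner_add_left, hf, hg]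
    | hsmul c u => simp [inner_smul_left, hST]

/-- The projection on the GNS space given by a letter. -/
noncomputable def op (s : Letter) : h.GNS →L[ℂ] h.GNS :=
  ((h.leftMul s).mkContinuous 1 fun f => by simpa using h.norm_leftMul_le s f).completion

theorem op_vec (s : Letter) (w : Word) : h.op s (h.vec w) = h.vec (s :: w) := by
  simp [op, vec, leftMul_preVec]

theorem isStarProjection_op (s : Letter) : IsStarProjection (h.op s) where
  isIdempotentElem := h.clm_ext fun u v => by
    simp [mul_apply_eq_comp, op_vec, inner_vec, h.idem]
  isSelfAdjoint := by
    refine h.clm_ext fun u v => ?_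
    rw [ContinuousLinearMap.star_eq_adjoint, ContinuousLinearMap.adjoint_inner_right]
    simp [op_vec, inner_vec]

theorem op_comm (x y : ℕ × ℕ) :
    h.op (false, x) * h.op (true, y) = h.op (true, y) * h.op (false, x) :=
  h.clm_ext fun u v => by simp [mul_apply_eq_comp, op_vec, inner_vec, h.comm]

theorem isPVM_op {t : Bool × ℕ} (ht : t.2 < n) :
    IsPVM fun a : Fin m => h.op (t.1, t.2, (a : ℕ)) := by
  refine ⟨fun a => h.isStarProjection_op _, h.clm_ext fun u v => ?_⟩
  rw [sum_apply, inner_sum]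
  simp only [op_vec, inner_vec, one_apply_eq_self]
  exact_mod_cast h.pvm t ht u.reverse v

/-- The state is the vector of the empty word; applying letters to it and pairing with it returns
`φ`. -/
theorem momentCorrelation_mem (h : IsSyncMoment n m φ) : momentCorrelation n m φ ∈ CqcSync n m := by
  refine ⟨⟨h.GNS, inferInstance, inferInstance, inferInstance, inferInstance,
    fun x a => h.op (false, x, a), fun y b => h.op (true, y, b), h.vec [], ?_,
    fun x => h.isPVM_op (t := (false, x)) x.2, fun y => h.isPVM_op (t := (true, y)) y.2,
    fun x y a b => h.op_comm _ _, fun a b x y => ?_⟩, fun a b x hab => ?_⟩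
  · have h2 : ‖h.vec []‖ ^ 2 = 1 := by
      rw [norm_sq_eq_re_inner (𝕜 := ℂ), inner_vec]
      simp [h.one]
    exact (pow_eq_one_iff_of_nonneg (norm_nonneg _) two_ne_zero).1 h2
  · simp [op_vec, inner_vec, momentCorrelation]
  · exact h.sync _ _ _ fun h => hab (Fin.ext h)

end IsSyncMoment

/-! ### The value of a game and the conclusion. -/

/-- A crude bound suffices: it only serves to make the supremum well behaved. -/
theorem NonlocalGame.winProb_le (G : NonlocalGame) {p : Correlation G.n G.m}
    (hp : ∀ a b x y, p a b x y ≤ 1) : G.winProb p ≤ (G.m : ℝ) * G.m := by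
  have h : ∀ v w, G.μ v w * ∑ i, ∑ j, (if G.D v w i j then (1 : ℝ) else 0) * p i j v w ≤
      G.μ v w * (G.m * G.m) := fun v w => by
    refine mul_le_mul_of_nonneg_left ?_ (G.μ_nonneg v w)
    calc _ ≤ ∑ _i : Fin G.m, ∑ _j : Fin G.m, (1 : ℝ) :=
          Finset.sum_le_sum fun i _ => Finset.sum_le_sum fun j _ => by
            split_ifs
            · simpa using hp i j v w
            · simp
      _ = _ := by simp
  calc G.winProb p ≤ ∑ v, ∑ w, G.μ v w * (G.m * G.m) :=
        Finset.sum_le_sum fun v _ => Finset.sum_le_sum fun w _ => h v w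
    _ = _ := by simp only [← Finset.sum_mul, G.μ_sum, one_mul]

theorem Cqc.le_one {n m : ℕ} {p : Correlation n m} (hp : p ∈ Cqc n m) (a b : Fin m)
    (x y : Fin n) : p a b x y ≤ 1 := by
  obtain ⟨H, _, _, _, _, A, B, ξ, hξ, hA, hB, -, hpe⟩ := hp
  have h1 : ‖(p a b x y : ℂ)‖ ≤ 1 := by
    rw [hpe]
    calc _ ≤ ‖ξ‖ * ‖A x a (B y b ξ)‖ := norm_inner_le_norm _ _
      _ ≤ ‖ξ‖ * ‖ξ‖ := mul_le_mul_of_nonneg_left ((((hA x).1 a).norm_apply_le _).trans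
          (((hB y).1 b).norm_apply_le _)) (norm_nonneg _)
      _ = 1 := by rw [hξ, one_mul]
  rw [Complex.norm_real] at h1
  exact (le_abs_self _).trans h1

theorem NonlocalGame.bddAbove_winProb (G : NonlocalGame) :
    BddAbove (G.winProb '' CqcSync G.n G.m) := by
  refine ⟨G.m * G.m, ?_⟩
  rintro _ ⟨p, hp, rfl⟩
  exact G.winProb_le (Cqc.le_one hp.1)

/-- The value of a game is less than `r` if and only if the moment problem for some rational winning
probability below `r` has no solution. -/
theorem NonlocalGame.sValCo_lt_iff (G : NonlocalGame) {d : ℕ → ℕ → ℕ → ℕ → Bool}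
    {q : ℕ → ℕ → ℕ → ℕ} (hd : ∀ (v w : Fin G.n) (i j : Fin G.m), d v w i j = G.D v w i j)
    (hq : ∀ (v w : Fin G.n) (k : ℕ), |G.μ v w - (q v w k : ℝ) / 2 ^ k| ≤ 1 / 2 ^ k) {r : ℝ}
    (hr : 0 < r) : G.sValCo < r ↔ ∃ x : ℕ × ℕ, (x.1 : ℝ) / ((x.2 : ℝ) + 1) < r ∧
      ¬ LinForm.Feasible ((G.data d q).system x.1 x.2) := by
  constructor
  · intro h
    -- The maximum with 0 makes `y` positive, so that it is a fraction of natural numbers.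
    obtain ⟨y, hy1, hy2⟩ := exists_rat_btwn (max_lt h hr)
    have hy0 : (0 : ℝ) < y := (le_max_right _ _).trans_lt hy1
    have hy0' : 0 < y := by exact_mod_cast hy0
    have hden : ((y.den - 1 : ℕ) : ℝ) + 1 = y.den := by
      have := y.pos
      exact_mod_cast Nat.sub_add_cancel this
    have hye : (y.num.toNat : ℝ) / (((y.den - 1 : ℕ) : ℝ) + 1) = y := by
      have h1 : ((y.num.toNat : ℤ) : ℝ) = y.num := by
        rw [Int.toNat_of_nonneg (Rat.num_nonneg.2 hy0'.le)]
      rw [hden, Rat.cast_def, ← h1, Int.cast_natCast]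
    refine ⟨(y.num.toNat, y.den - 1), by rwa [hye], fun hf => ?_⟩
    obtain ⟨φ, hφ, hk⟩ := (GameData.feasible_iff _ _ _).1 hf
    rw [winForm_eval_nonneg_iff G hd hq hφ.one hφ.abs_le, hye] at hk
    have := le_csSup G.bddAbove_winProb ⟨_, hφ.momentCorrelation_mem, rfl⟩
    exact absurd ((le_max_left _ _).trans_lt hy1) (not_lt.2 (hk.trans this))
  · rintro ⟨⟨a, b⟩, hab, hf⟩
    by_contra! hle
    -- Without correlations the value would be 0, contradicting `0 < r`.
    have hne : (G.winProb '' CqcSync G.n G.m).Nonempty := by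
      by_contra hne
      rw [Set.not_nonempty_iff_eq_empty] at hne
      rw [sValCo, hne, Real.sSup_empty] at hle
      exact absurd hr (not_lt.2 hle)
    -- The strict inequality `a / (b + 1) < r` yields a correlation without needing the supremum to
    -- be attained.
    obtain ⟨_, ⟨p, hp, rfl⟩, hlt⟩ := exists_lt_of_lt_csSup hne (hab.trans_le hle)
    exact hf (feasible_of_mem_cqcSync G hd hq hp hlt.le)

theorem mainTheorem6 (r : ℝ) (hr0 : 0 < r) (hr1 : r ≤ 1) (hr : LowerSemicomputable r) :
    MIPcoSync r ⊆ coRE := by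
  rintro L ⟨G, ⟨hn, hm, ⟨d, hdc, hd⟩, ⟨q, hqc, hq⟩⟩, hL⟩
  let E : List Bool → GameData := fun z =>
    (G z).data (fun v w i j => d (z, v, w, i, j)) (fun v w k => q (z, v, w, k))
  have hD : Computable fun x : List Bool × ℕ × ℕ × ℕ × ℕ =>
      (E x.1).D x.2.1 x.2.2.1 x.2.2.2.1 x.2.2.2.2 := hdc
  have hQ : Computable fun x : List Bool × ℕ × ℕ × ℕ => (E x.1).q x.2.1 x.2.2.1 x.2.2.2 := hqc
  have hr' : REPred fun x : List Bool × ℕ × ℕ => (x.2.1 : ℝ) / ((x.2.2 : ℝ) + 1) < r :=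
    REPred.comp hr Computable.snd
  have h1 := (REPred.and hr' (GameData.re_not_feasible (E := E) hn hm hD hQ)).exists_right
  have h2 : ∀ z, (∃ x : ℕ × ℕ, (x.1 : ℝ) / ((x.2 : ℝ) + 1) < r ∧
      ¬ LinForm.Feasible ((E z).system x.1 x.2)) ↔ z ∉ L := fun z => by
    rw [hL, not_le]
    exact ((G z).sValCo_lt_iff (hd z) (hq z) hr0).symm
  change REPred fun z => z ∉ L
  exact h1.of_eq h2
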